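/- Setting. Let $\mathcal J$ be a finite set of jobs and $\mathcal M$ a set of $m\ge 1$ identical parallel machines. The processing times $P_j$ ($j\in\mathcal J$) are independent non-negative random variables with finite expectations, not all of which are $0$. Put $T:=2\max\{\frac1m\sum_{j\in\mathcal J}\mathbb E[P_j],\ \max_{j\in\mathcal J}\mathbb E[P_j]\}$, let $\delta\ge 0$ and $\alpha>4$ be constants, and let $\tau_k:=k(\delta+\alpha T)$ for $k\ge 0$. The LEPT assignment of a set of jobs to a non-empty set of machines goes through the jobs in order of non-increasing expected processing time and appends each job to the queue of a machine whose expected load is smallest at that moment (ties are broken by an arbitrary fixed rule). The policy $\mathrm{LEPT}_{\delta,\alpha}$ works in rounds. At time $\tau_0=0$ all jobs are assigned to all machines by the LEPT assignment. At each time $\tau_k$, $k\ge1$, all jobs that have not been started before $\tau_k$ are reassigned, by the LEPT assignment, to the machines that have been available at each of the times $\tau_1,\dots,\tau_k$; a machine is available at $\tau_i$ if no job is in process on it at time $\tau_i$. (If there is no such machine, no job is assigned.) The jobs assigned at time $\tau_k$ are processed on their machines in queue order and without idle time from a fixed time $r_k\in[\tau_k,\tau_k+\delta]$ on, where $r_0,r_1,\dots$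 are deterministic (for example $r_0=0$ and $r_k=\tau_k+\delta$ for $k\ge 1$); jobs that do not start before $\tau_{k+1}$ are reassigned at $\tau_{k+1}$. For $k\ge 0$ let $\Xi_k$ be the sum of $\mathbb E[P_j]$ over all jobs $j$ that have not been started before $\tau_k$, divided by $Tm$, and let $A_k$ be the fraction of the machines that are available at each of the times $\tau_1,\dots,\tau_k$ (so $A_0=1$). Statement. Let $k\ge 1$, $\xi\in(0,1)$ and $a\in[\frac12,1]$. (1) If $\mathbb P(\Xi_k\le\xi,\ A_k\ge a)>0$, then for all $u\in\mathbb R$ (in particular for all $u\in(0,1)$) $$\mathbb P\bigl(\Xi_{k+1}\le u\bigm|\Xi_k\le\xi,\ A_k\ge a\bigr)\ \ge\ \mathbb P\Bigl(\tfrac{2\xi}{am}\,Y\le u\Bigr),\qquad Y\sim\mathrm{Bin}\Bigl(m,\tfrac{2\xi}{a\alpha}\Bigr).$$ (2) If $\mathbb P(\Xi_{k-1}\le\xi,\ A_k\ge a)>0$, then for all $u\in\mathbb R$ (in particular for all $u\in(0,1)$) $$\mathbb P\bigl(A_{k+1}\ge u\bigm|\Xi_{k-1}\le\xi,\ A_k\ge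 a\bigr)\ \ge\ \mathbb P\Bigl(\tfrac1m Z\ge u\Bigr),\qquad Z\sim\mathrm{Bin}\Bigl(\lceil am\rceil,\,1-\tfrac{2\xi}{a\alpha}\Bigr).$$ -/

import Mathlib

open MeasureTheory ProbabilityTheory

noncomputable section

namespace StochScheduling

/-- A version of the LEPT rule for jobs `J` with expected processing times `e` on machines `M`:
`order` lists all jobs by non-increasing expected processing time, and `pick S load` is a least
loaded machine of the non-empty set `S`. Ties are broken in an arbitrary but fixed way. -/
structure LEPTRule (J M : Type*) (e : J → ℝ) where
  order : List J
  nodup : order.Nodup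
  mem_order : ∀ j, j ∈ order
  sorted : order.Pairwise (fun j j' => e j' ≤ e j)
  pick : Finset M → (M → ℝ) → M
  pick_mem : ∀ (S : Finset M) (load : M → ℝ), S.Nonempty → pick S load ∈ S
  pick_le : ∀ (S : Finset M) (load : M → ℝ), ∀ i ∈ S, load (pick S load) ≤ load i

/-- What is known about the schedule when a round begins: the jobs that have not been started, and
the machines that have been available at the beginning of every round so far. -/
structure RoundState (J M : Type*) where
  remaining : Finset J
  available : Finset M

variable {J M : Type*}

/-- The LEPT fixed assignment of the jobs in `R` to the machines in `A`: job after job, in the order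
of `rule`, each job is appended to the queue of a machine in `A` whose expected load is least.
(If `A` is empty, then nothing is assigned.) -/
def leptQueues [DecidableEq J] [DecidableEq M] {e : J → ℝ} (rule : LEPTRule J M e)
    (R : Finset J) (A : Finset M) : M → List J :=
  (rule.order.filter (fun j => j ∈ R)).foldl
    (fun q j =>
      if A.Nonempty then
        let i := rule.pick A (fun i => ((q i).map e).sum)
        Function.update q i (q i ++ [j])
      else q)
    (fun _ => [])

/-- The start time of job `j` in the queue `l` under the processing times `p`, if the queue is
processed without idle time from time `r` on. -/
def startTime [DecidableEq J] (p : J → ℝ) (r : ℝ) (l : List J) (j : J) : ℝ :=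
  r + ((l.takeWhile (fun j' => j' ≠ j)).map p).sum

/-- One round, from the state `s` at its beginning to the state at time `t`. The remaining jobs are
assigned to the available machines by LEPT, and each machine processes its queue from time `r` on,
under the processing times `p`. The jobs that are not started before time `t` remain, and a machine
stays available if no job is in process on it at time `t`. -/
def nextState [DecidableEq J] [DecidableEq M] [Fintype M] {e : J → ℝ} (rule : LEPTRule J M e)
    (p : J → ℝ) (r t : ℝ) (s : RoundState J M) : RoundState J M where
  remaining := s.remaining.filter (fun j =>
    ∀ i : M, j ∈ leptQueues rule s.remaining s.available i →
      t ≤ startTime p r (leptQueues rule s.remaining s.available i) j)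
  available := s.available.filter (fun i =>
    ∀ j ∈ leptQueues rule s.remaining s.available i,
      startTime p r (leptQueues rule s.remaining s.available i) j < t →
        startTime p r (leptQueues rule s.remaining s.available i) j + p j ≤ t)

/-- `T = 2 max {(1/m) ∑ⱼ E[Pⱼ], maxⱼ E[Pⱼ]}`. -/
def horizon [Fintype J] (M : Type*) [Fintype M] (e : J → ℝ) : ℝ :=
  2 * max ((∑ j, e j) / (Fintype.card M : ℝ)) (⨆ j, e j)

/-- `τ_k = k (δ + α T)`. -/
def tau [Fintype J] (M : Type*) [Fintype M] (e : J → ℝ) (δ α : ℝ) (k : ℕ) : ℝ :=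
  k * (δ + α * horizon M e)

/-- The state of the policy `LEPT_{δ,α}` at time `τ_k`, for the realization `p` of the processing
times. Round `k` is the time between `τ_k` and `τ_{k+1}`; the processing of the jobs that are
assigned at `τ_k` begins at time `r k`. Round `0` is the initial LEPT assignment of all jobs to all
machines. -/
def state [DecidableEq J] [DecidableEq M] [Fintype J] [Fintype M] {e : J → ℝ}
    (rule : LEPTRule J M e) (δ α : ℝ) (r : ℕ → ℝ) (p : J → ℝ) : ℕ → RoundState J M
  | 0 => ⟨Finset.univ, Finset.univ⟩
  | k + 1 => nextState rule p (r k) (tau M e δ α (k + 1)) (state rule δ α r p k)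

/-- `Ξ_k`: the total expected processing time of the jobs that have not been started before `τ_k`,
divided by `T m`. -/
def Xi [DecidableEq J] [DecidableEq M] [Fintype J] [Fintype M] {e : J → ℝ}
    (rule : LEPTRule J M e) (δ α : ℝ) (r : ℕ → ℝ) (k : ℕ) (p : J → ℝ) : ℝ :=
  (∑ j ∈ (state rule δ α r p k).remaining, e j) / (horizon M e * (Fintype.card M : ℝ))

/-- `A_k`: the fraction of the machines that are available at each of the times `τ_1, …, τ_k`. -/
def Avail [DecidableEq J] [DecidableEq M] [Fintype J] [Fintype M] {e : J → ℝ}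
    (rule : LEPTRule J M e) (δ α : ℝ) (r : ℕ → ℝ) (k : ℕ) (p : J → ℝ) : ℝ :=
  ((state rule δ α r p k).available.card : ℝ) / (Fintype.card M : ℝ)

end StochScheduling

end

namespace StochScheduling

/-! Fix the states at the two times `τ_{k-1}` and `τ_k`. They are determined by the processing times
of the jobs started before `τ_k` (`state_congr`). Hence this history is independent of the
processing times of the remaining jobs, whereas the queues formed at `τ_k` are fixed by the state at
`τ_k`. So, given the history, the queue loads are independent sums over disjoint sets of jobs, with
their original distributions (`mul_measure_state_eq_le`). There are finitely many histories, and a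
bound valid for each passes to the conditional probability (`le_cond_of_fiberwise`).

Under LEPT, the last job of a queue with at least two jobs is appended when the expected load is at
most the average, and its own expectation is at most that of the first job in the queue. So the
expected load is at most twice the average, that is, at most `2ξT/a`. The round lasts at least `αT`
from the start of processing, and by Markov's inequality the queue overruns with probability at most
`2ξ/(aα)`.

For (1), a job that remains is not first in its queue, so it lies in an overrunning queue of at
least two jobs. There are at most `m` such queues, each contributing at most `2ξT/a`. For (2),
queues with a single job matter as well. A job remaining at `τ_k` was not first in its queue in the
preceding round, so its expectation is at most the average load of that round. This is why (2)
conditions on `Ξ_{k-1}`. Comparison with the binomial law is by induction on the number of machines.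
-/

lemma binomial_succ_real (n : ℕ) (p : unitInterval) (s : Set ℕ) :
    (binomial (n + 1) p).real s =
      p * (binomial n p).real (Nat.succ ⁻¹' s) + (1 - p) * (binomial n p).real s := by
  -- Conditioning on the outcome of one trial; on singletons this is Pascal's rule.
  have h : binomial (n + 1) p =
      unitInterval.toNNReal p • (binomial n p).map Nat.succ +
        unitInterval.toNNReal (unitInterval.symm p) • binomial n p := by
    refine Measure.ext_of_measureReal_singleton fun k => ?_
    rw [measureReal_add_apply, measureReal_nnreal_smul_apply, measureReal_nnreal_smul_apply,
      map_measureReal_apply .of_discrete .of_discrete]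
    simp only [unitInterval.coe_toNNReal, unitInterval.coe_symm_eq]
    rcases k with _ | k
    · have : Nat.succ ⁻¹' {0} = ∅ := by ext; simp
      simp only [this, measureReal_empty, binomial_real_singleton]
      simp
      ring
    · have : Nat.succ ⁻¹' {k + 1} = {k} := by ext; simp
      rw [this]
      simp only [binomial_real_singleton, Nat.choose_succ_succ, Nat.succ_eq_add_one]
      rcases lt_or_ge k n with hk | hk
      · have h1 : n + 1 - (k + 1) = n - k := by omega
        obtain ⟨d, rfl⟩ : ∃ d, n = k + 1 + d := ⟨n - (k + 1), by omega⟩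
        have h2 : k + 1 + d - k = d + 1 := by omega
        have h3 : k + 1 + d - (k + 1) = d := by omega
        rw [h1, h2, h3]
        push_cast
        ring
      -- Here `n - (k + 1)` is truncated, but its coefficient vanishes.
      · have h1 : n.choose (k + 1) = 0 := Nat.choose_eq_zero_of_lt (by omega)
        have h2 : n + 1 - (k + 1) = n - k := by omega
        rw [h1, h2]
        push_cast
        ring
  rw [h, measureReal_add_apply, measureReal_nnreal_smul_apply, measureReal_nnreal_smul_apply,
      map_measureReal_apply .of_discrete .of_discrete]
  simp

/-! ### Counting independent events and comparison with the binomial distribution. -/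

section Independence

variable {ι J Ω : Type*} [MeasurableSpace Ω] {μ : Measure Ω} {P : J → Ω → ℝ}

/-- Functions of disjoint sets of independent random variables are independent. -/
lemma indepFun_of_dependsOn (hP : iIndepFun P μ) (hPm : ∀ j, Measurable (P j))
    {β γ : Type*} [MeasurableSpace β] [MeasurableSpace γ] {f : (J → ℝ) → β} {g : (J → ℝ) → γ}
    {D D' : Finset J} (hf : Measurable f) (hg : Measurable g)
    (hfD : DependsOn f D) (hgD : DependsOn g D') (hD : Disjoint D D') :
    IndepFun (fun ω => f (fun j => P j ω)) (fun ω => g (fun j => P j ω)) μ := by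
  classical
  -- Extension by zero turns a function that depends only on `D` into a measurable function of the
  -- restriction to `D`.
  have key : ∀ D : Finset J, Measurable fun (v : D → ℝ) (j : J) =>
      if h : j ∈ D then v ⟨j, h⟩ else 0 := by
    intro D
    refine measurable_pi_lambda _ fun j => ?_
    by_cases h : j ∈ D
    · simpa [h] using measurable_pi_apply _
    · simp [h]
  have h := (hP.indepFun_finset D D' hD hPm).comp (hf.comp (key D)) (hg.comp (key D'))
  convert h using 1
  · funext ω
    exact hfD fun j hj => by simp [Finset.mem_coe.1 hj]
  · funext ω
    exact hgD fun j hj => by simp [Finset.mem_coe.1 hj]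

lemma measureReal_inter_of_dependsOn (hP : iIndepFun P μ) (hPm : ∀ j, Measurable (P j))
    {B C : (J → ℝ) → Prop} {D D' : Finset J} (hB : MeasurableSet {p | B p})
    (hC : MeasurableSet {p | C p}) (hBD : DependsOn B D) (hCD : DependsOn C D')
    (hD : Disjoint D D') :
    μ.real {ω | B (fun j => P j ω) ∧ C (fun j => P j ω)} =
      μ.real {ω | B (fun j => P j ω)} * μ.real {ω | C (fun j => P j ω)} := by
  have h := (indepFun_of_dependsOn hP hPm (measurableSet_setOfPred.1 hB) (measurableSet_setOfPred.1 hC)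
    hBD hCD hD).measure_inter_preimage_eq_mul {True} {True} trivial trivial
  have := congrArg ENNReal.toReal h
  rw [ENNReal.toReal_mul] at this
  simpa [Measure.real, Set.preimage, ← Set.ofPred_and] using this

open scoped Classical in
/-- The number of indices in `S` whose event in the family `B` occurs. -/
noncomputable def countEvents (S : Finset ι) (B : ι → (J → ℝ) → Prop) (p : J → ℝ) : ℕ :=
  (S.filter fun i => B i p).card

lemma measurable_countEvents (S : Finset ι) {B : ι → (J → ℝ) → Prop}
    (hB : ∀ i, MeasurableSet {p | B i p}) : Measurable (countEvents S B) := by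
  classical
  have : countEvents S B = fun p => ∑ i ∈ S, if B i p then 1 else 0 := by
    funext p
    simp [countEvents]
  rw [this]
  exact Finset.measurable_fun_sum _ fun i _ =>
    Measurable.ite (hB i) measurable_const measurable_const

lemma dependsOn_countEvents [DecidableEq J] (S : Finset ι) {B : ι → (J → ℝ) → Prop}
    {D : ι → Finset J} (hBD : ∀ i, DependsOn (B i) (D i)) :
    DependsOn (countEvents S B) (S.biUnion D : Finset J) := by
  classical
  intro p p' h
  unfold countEvents
  congr 1
  refine Finset.filter_congr fun i hi => ?_
  rw [hBD i fun j hj => h j (by simpa using ⟨i, hi, hj⟩)]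

/-- Split according to whether event `i` occurs; it is independent of the count over `S`. The result
has the shape of `binomial_succ_real`. -/
lemma measureReal_countEvents_insert [DecidableEq ι] [DecidableEq J] [IsProbabilityMeasure μ]
    (hP : iIndepFun P μ) (hPm : ∀ j, Measurable (P j)) {S : Finset ι} {i : ι} (hi : i ∉ S)
    {B : ι → (J → ℝ) → Prop} {D : ι → Finset J}
    (hB : ∀ i, MeasurableSet {p | B i p}) (hBD : ∀ i, DependsOn (B i) (D i))
    (hD : Pairwise fun i i' => Disjoint (D i) (D i')) (L : Set ℕ) :
    μ.real {ω | countEvents (insert i S) B (fun j => P j ω) ∈ L} =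
      μ.real {ω | B i fun j => P j ω} *
          μ.real {ω | countEvents S B (fun j => P j ω) ∈ Nat.succ ⁻¹' L} +
        (1 - μ.real {ω | B i fun j => P j ω}) *
          μ.real {ω | countEvents S B (fun j => P j ω) ∈ L} := by
  classical
  have hPm' : Measurable fun ω j => P j ω := measurable_pi_lambda _ hPm
  have hBm : MeasurableSet {ω | B i fun j => P j ω} := hPm' (hB i)
  have hdisj : Disjoint (D i) (S.biUnion D) := by
    rw [Finset.disjoint_biUnion_right]
    exact fun i' hi' => hD fun h => hi (h ▸ hi')
  have hcm : ∀ L : Set ℕ, MeasurableSet {p | countEvents S B p ∈ L} := fun L =>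
    measurable_countEvents S hB .of_discrete
  have hcD : ∀ L : Set ℕ, DependsOn (fun p => countEvents S B p ∈ L) (S.biUnion D : Finset J) :=
    fun L p p' h => by simp only [dependsOn_countEvents S hBD h]
  rw [← measureReal_inter_add_sdiff (μ := μ)
    (s := {ω | countEvents (insert i S) B (fun j => P j ω) ∈ L}) hBm]
  congr 1
  · rw [← measureReal_inter_of_dependsOn hP hPm (hB i) (hcm _) (hBD i) (hcD _) hdisj]
    congr 1
    ext ω
    simp only [Set.mem_inter_iff, Set.mem_ofPred_eq, Set.mem_preimage]
    rw [and_comm, and_congr_right_iff]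
    intro h
    rw [countEvents, Finset.filter_insert, if_pos h, Finset.card_insert_of_notMem (by simp [hi])]
    rfl
  · have hc : μ.real {ω | ¬ B i fun j => P j ω} = 1 - μ.real {ω | B i fun j => P j ω} :=
      probReal_compl_eq_one_sub hBm
    rw [← hc, ← measureReal_inter_of_dependsOn (B := fun p => ¬ B i p) hP hPm (hB i).compl (hcm _)
      (fun p p' h => by simp only [hBD i h]) (hcD _) hdisj]
    congr 1
    ext ω
    simp only [Set.mem_sdiff, Set.mem_ofPred_eq]
    rw [and_comm, and_congr_right_iff]
    intro h
    rw [countEvents, Finset.filter_insert, if_neg h]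
    rfl

/-- The number of at most `n` independent events of probability at most `p` is stochastically
dominated by the binomial distribution. -/
lemma binomial_real_le_of_isLowerSet [IsProbabilityMeasure μ]
    (hP : iIndepFun P μ) (hPm : ∀ j, Measurable (P j)) {S : Finset ι}
    {B : ι → (J → ℝ) → Prop} {D : ι → Finset J}
    (hB : ∀ i, MeasurableSet {p | B i p}) (hBD : ∀ i, DependsOn (B i) (D i))
    (hD : Pairwise fun i i' => Disjoint (D i) (D i')) {q : unitInterval}
    (hq : ∀ i ∈ S, μ.real {ω | B i fun j => P j ω} ≤ q) {n : ℕ} (hn : S.card ≤ n)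
    {L : Set ℕ} (hL : IsLowerSet L) :
    (binomial n q).real L ≤ μ.real {ω | countEvents S B (fun j => P j ω) ∈ L} := by
  classical
  induction S using Finset.induction_on generalizing n L with
  | empty =>
    by_cases h0 : 0 ∈ L
    · simp [countEvents, h0, measureReal_le_one]
    · have : L = ∅ := by
        ext y
        simpa using fun hy => h0 (hL (Nat.zero_le y) hy)
      simp [this]
  | insert i S hi ih =>
    rw [Finset.card_insert_of_notMem hi] at hn
    obtain ⟨n, rfl⟩ : ∃ n', n = n' + 1 := ⟨n - 1, by omega⟩
    rw [measureReal_countEvents_insert hP hPm hi hB hBD hD, binomial_succ_real]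
    have hq' : ∀ i' ∈ S, μ.real {ω | B i' fun j => P j ω} ≤ q := fun i' h =>
      hq i' (Finset.mem_insert_of_mem h)
    have hL' : IsLowerSet (Nat.succ ⁻¹' L) := fun a b hab ha => hL (Nat.succ_le_succ hab) ha
    have h1 := ih hq' (n := n) (by omega) hL
    have h2 := ih hq' (n := n) (by omega) hL'
    have h3 := hq i (Finset.mem_insert_self _ _)
    have h4 : μ.real {ω | countEvents S B (fun j => P j ω) ∈ Nat.succ ⁻¹' L} ≤
        μ.real {ω | countEvents S B (fun j => P j ω) ∈ L} :=
      measureReal_mono fun ω h => hL (Nat.le_succ _) h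
    have h5 := q.2.1
    have h6 := q.2.2
    -- A mixture `b x + (1 - b) y` with `x ≤ y` (`h4`) decreases in `b`, so replacing `b ≤ q` by `q`
    -- only lowers it.
    nlinarith [mul_le_mul_of_nonneg_left h2 h5, mul_le_mul_of_nonneg_left h1 (sub_nonneg.2 h6),
      mul_nonneg (sub_nonneg.2 h3) (sub_nonneg.2 h4)]

/-- The number of at least `n` independent events of probability at least `p` stochastically
dominates the binomial distribution. -/
lemma binomial_real_le_of_isUpperSet [IsProbabilityMeasure μ]
    (hP : iIndepFun P μ) (hPm : ∀ j, Measurable (P j)) {S : Finset ι}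
    {B : ι → (J → ℝ) → Prop} {D : ι → Finset J}
    (hB : ∀ i, MeasurableSet {p | B i p}) (hBD : ∀ i, DependsOn (B i) (D i))
    (hD : Pairwise fun i i' => Disjoint (D i) (D i')) {q : unitInterval}
    (hq : ∀ i ∈ S, q ≤ μ.real {ω | B i fun j => P j ω}) {n : ℕ} (hn : n ≤ S.card)
    {U : Set ℕ} (hU : IsUpperSet U) :
    (binomial n q).real U ≤ μ.real {ω | countEvents S B (fun j => P j ω) ∈ U} := by
  classical
  have hzero : ∀ (S : Finset ι) {U : Set ℕ}, IsUpperSet U →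
      (binomial 0 q).real U ≤ μ.real {ω | countEvents S B (fun j => P j ω) ∈ U} := by
    intro S U hU
    by_cases h0 : 0 ∈ U
    · have : ∀ y, y ∈ U := fun y => hU (Nat.zero_le y) h0
      simp [this, measureReal_le_one]
    · simp [binomial_zero, measureReal_def, h0]
  induction S using Finset.induction_on generalizing n U with
  | empty =>
    obtain rfl : n = 0 := by simpa using hn
    exact hzero _ hU
  | insert i S hi ih =>
    rcases n with _ | n
    · exact hzero _ hU
    rw [Finset.card_insert_of_notMem hi] at hn
    rw [measureReal_countEvents_insert hP hPm hi hB hBD hD, binomial_succ_real]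
    have hq' : ∀ i' ∈ S, q ≤ μ.real {ω | B i' fun j => P j ω} := fun i' h =>
      hq i' (Finset.mem_insert_of_mem h)
    have hU' : IsUpperSet (Nat.succ ⁻¹' U) := fun a b hab ha => hU (Nat.succ_le_succ hab) ha
    have h1 := ih hq' (n := n) (by omega) hU
    have h2 := ih hq' (n := n) (by omega) hU'
    have h3 := hq i (Finset.mem_insert_self _ _)
    have h4 : μ.real {ω | countEvents S B (fun j => P j ω) ∈ U} ≤
        μ.real {ω | countEvents S B (fun j => P j ω) ∈ Nat.succ ⁻¹' U} :=
      measureReal_mono fun ω h => hU (Nat.le_succ _) h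
    have h5 := q.2.1
    have h6 := q.2.2
    nlinarith [mul_le_mul_of_nonneg_left h2 h5, mul_le_mul_of_nonneg_left h1 (sub_nonneg.2 h6),
      mul_nonneg (sub_nonneg.2 h3) (sub_nonneg.2 h4)]

end Independence

/-! ### Conditioning on finitely many histories. -/

/-- If `E` is determined by `g`, which takes finitely many values, then it suffices to bound the
conditional probability given each value of `g`. -/
lemma le_cond_of_fiberwise {Ω σ : Type*} [MeasurableSpace Ω] {μ : Measure Ω}
    [IsFiniteMeasure μ] [Finite σ] {g : Ω → σ} (hg : ∀ s, MeasurableSet (g ⁻¹' {s}))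
    {Q : σ → Prop} {F : Set Ω} {c : ENNReal} (hE : μ {ω | Q (g ω)} ≠ 0)
    (h : ∀ s, Q s → c * μ (g ⁻¹' {s}) ≤ μ (g ⁻¹' {s} ∩ F)) :
    c ≤ cond μ {ω | Q (g ω)} F := by
  classical
  have := Fintype.ofFinite σ
  have hpre : {ω | Q (g ω)} = g ⁻¹' (Finset.univ.filter Q : Finset σ) := by
    ext; simp
  have hm : MeasurableSet {ω | Q (g ω)} := by
    have : {ω | Q (g ω)} = ⋃ s ∈ Finset.univ.filter Q, g ⁻¹' {s} := by ext; simp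
    rw [this]
    exact Finset.measurableSet_biUnion _ fun s _ => hg s
  rw [cond_apply hm, mul_comm, ← div_eq_mul_inv,
    ENNReal.le_div_iff_mul_le (.inl hE) (.inl (measure_ne_top _ _))]
  have hsum : ∀ F : Set Ω, μ ({ω | Q (g ω)} ∩ F) =
      ∑ s ∈ Finset.univ.filter Q, μ (g ⁻¹' {s} ∩ F) := by
    intro F
    have := sum_measure_preimage_singleton (μ := μ.restrict F) (f := g)
      (Finset.univ.filter Q) fun s _ => hg s
    rw [← hpre, Measure.restrict_apply hm] at this
    rw [← this]
    exact Finset.sum_congr rfl fun s _ => Measure.restrict_apply (hg s)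
  have h0 := hsum Set.univ
  simp only [Set.inter_univ] at h0
  rw [hsum F, h0, Finset.mul_sum]
  exact Finset.sum_le_sum fun s hs => h s (Finset.mem_filter.1 hs).2

/-! ### LEPT queues, and dependence of the state on the processing times. -/

section Queues

variable {J M : Type*} {e : J → ℝ}

/-- The properties of the queues `q` on the machines `A` that hold after the jobs in the list `L`
have been assigned by LEPT. -/
structure IsLeptAssignment (e : J → ℝ) (A : Finset M) (L : List J) (q : M → List J) : Prop where
  mem : ∀ i, ∀ j ∈ q i, j ∈ L ∧ i ∈ A
  exists_mem : ∀ j ∈ L, ∃ i, j ∈ q i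
  unique : ∀ i i', ∀ j ∈ q i, j ∈ q i' → i = i'
  nodup : ∀ i, (q i).Nodup
  sum_load : ∑ i ∈ A, ((q i).map e).sum = (L.map e).sum
  card_mul_le : ∀ i x l, q i = x :: l → ∀ j ∈ l, A.card * e j ≤ (L.map e).sum
  card_mul_load_le : ∀ i, 2 ≤ (q i).length → A.card * ((q i).map e).sum ≤ 2 * (L.map e).sum

lemma RoundState.ext' {s s' : RoundState J M} (h : s.remaining = s'.remaining)
    (h' : s.available = s'.available) : s = s' := by
  cases s; cases s'; simp_all

lemma sum_map_order_filter [DecidableEq J] (rule : LEPTRule J M e) (R : Finset J) :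
    ((rule.order.filter (fun j => j ∈ R)).map e).sum = ∑ j ∈ R, e j := by
  rw [← List.sum_toFinset _ (rule.nodup.filter _)]
  refine Finset.sum_congr ?_ fun _ _ => rfl
  ext j
  simp [rule.mem_order]

section StartTime

variable [DecidableEq J]

lemma startTime_cons (p : J → ℝ) (r : ℝ) (x : J) (l : List J) (j : J) :
    startTime p r (x :: l) j = if x = j then r else startTime p (r + p x) l j := by
  unfold startTime
  by_cases h : x = j
  · simp [h]
  · simp [h, add_assoc]

lemma le_startTime {p : J → ℝ} (hp : ∀ j, 0 ≤ p j) (r : ℝ) (l : List J) (j : J) :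
    r ≤ startTime p r l j := by
  have : 0 ≤ ((l.takeWhile (fun j' => j' ≠ j)).map p).sum :=
    List.sum_nonneg (by simpa using fun x _ => hp x)
  unfold startTime
  linarith

lemma startTime_add_le {p : J → ℝ} (hp : ∀ j, 0 ≤ p j) (r : ℝ) {l : List J} {j : J} (hj : j ∈ l) :
    startTime p r l j + p j ≤ r + (l.map p).sum := by
  induction l generalizing r with
  | nil => simp at hj
  | cons x l ih =>
    rw [startTime_cons]
    simp only [List.map_cons, List.sum_cons]
    split_ifs with h
    · subst h
      have : 0 ≤ (l.map p).sum := List.sum_nonneg (by simpa using fun x _ => hp x)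
      linarith
    · have := ih (r + p x) ((List.mem_cons.1 hj).resolve_left (Ne.symm h))
      linarith

/-- Processing times of jobs that do not start before `t` do not influence what happens before
`t`. -/
lemma startTime_congr {p p' : J → ℝ} (hp : ∀ j, 0 ≤ p j) (hp' : ∀ j, 0 ≤ p' j) {r t : ℝ}
    {l : List J} (h : ∀ j ∈ l, startTime p r l j < t → p j = p' j) {j : J} (hj : j ∈ l) :
    startTime p' r l j = startTime p r l j ∨
      t ≤ startTime p r l j ∧ t ≤ startTime p' r l j := by
  induction l generalizing r with
  | nil => simp at hj
  | cons x l ih =>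
    -- If `t ≤ r`, nothing in the queue starts before `t`. Otherwise the head does, so its
    -- processing time is the same under both realizations, and the tails begin simultaneously.
    rcases le_or_gt t r with htr | hrt
    · exact .inr ⟨htr.trans (le_startTime hp _ _ _), htr.trans (le_startTime hp' _ _ _)⟩
    · have hx : p x = p' x := h x List.mem_cons_self (by simpa [startTime_cons] using hrt)
      rw [startTime_cons, startTime_cons]
      split_ifs with hxj
      · exact .inl rfl
      · rw [← hx]
        refine ih (fun j' hj' hlt => ?_) ((List.mem_cons.1 hj).resolve_left (Ne.symm hxj))
        by_cases hxj' : x = j'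
        · exact hxj' ▸ hx
        · exact h j' (List.mem_cons_of_mem _ hj') (by rwa [startTime_cons, if_neg hxj'])

omit [DecidableEq J] in
lemma measurable_sum_map (l : List J) : Measurable fun p : J → ℝ => (l.map p).sum := by
  induction l with
  | nil => simp
  | cons x l ih =>
    simp only [List.map_cons, List.sum_cons]
    exact (measurable_pi_apply x).add ih

lemma measurable_startTime (r : ℝ) (l : List J) (j : J) :
    Measurable fun p : J → ℝ => startTime p r l j :=
  measurable_const.add (measurable_sum_map _)

end StartTime

variable [DecidableEq M]

/-- The two load bounds rest on `havg` (the least load is at most the average) and `hfirst` (the new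
job is no larger than any job already queued, hence no larger than the load it is appended to,
unless the queue is empty). -/
lemma IsLeptAssignment.append (he : ∀ j, 0 ≤ e j) {A : Finset M} {L : List J} {q : M → List J}
    (h : IsLeptAssignment e A L q) {j : J} (hj : j ∉ L) (hjL : ∀ x ∈ L, e j ≤ e x) {i : M}
    (hi : i ∈ A) (hle : ∀ i' ∈ A, ((q i).map e).sum ≤ ((q i').map e).sum) :
    IsLeptAssignment e A (L ++ [j]) (Function.update q i (q i ++ [j])) := by
  have hjq : ∀ i', j ∉ q i' := fun i' hm => hj (h.mem i' j hm).1
  have havg : A.card * ((q i).map e).sum ≤ (L.map e).sum := by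
    rw [← h.sum_load, ← nsmul_eq_mul]
    exact Finset.card_nsmul_le_sum _ _ _ hle
  have hsum : ((L ++ [j]).map e).sum = (L.map e).sum + e j := by simp
  have hself : ((q i ++ [j]).map e).sum = ((q i).map e).sum + e j := by simp
  have hcard : (0 : ℝ) ≤ A.card := Nat.cast_nonneg _
  have hfirst : ∀ x ∈ q i, e j ≤ ((q i).map e).sum := fun x hx =>
    (hjL x (h.mem i x hx).1).trans
      (List.single_le_sum (by simpa using fun y _ => he y) _ (List.mem_map_of_mem hx))
  refine ⟨?_, ?_, ?_, ?_, ?_, ?_, ?_⟩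
  · intro i' j' hj'
    rcases eq_or_ne i' i with rfl | hne
    · simp only [Function.update_self, List.mem_append, List.mem_singleton] at hj'
      rcases hj' with hj' | rfl
      · simpa [hi] using .inl (h.mem _ _ hj').1
      · simp [hi]
    · rw [Function.update_of_ne hne] at hj'
      simpa [(h.mem _ _ hj').2] using .inl (h.mem _ _ hj').1
  · intro j' hj'
    rcases List.mem_append.1 hj' with hj' | hj'
    · obtain ⟨i', hi'⟩ := h.exists_mem j' hj'
      refine ⟨i', ?_⟩
      rcases eq_or_ne i' i with rfl | hne
      · simp [hi']
      · rwa [Function.update_of_ne hne]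
    · exact ⟨i, by simpa using .inr (List.mem_singleton.1 hj')⟩
  · intro i₁ i₂ j' h₁ h₂
    rcases eq_or_ne i₁ i with rfl | hne₁ <;> rcases eq_or_ne i₂ i₁ with rfl | hne₂
    · rfl
    · rw [Function.update_of_ne hne₂] at h₂
      simp only [Function.update_self, List.mem_append, List.mem_singleton] at h₁
      rcases h₁ with h₁ | rfl
      · exact h.unique _ _ _ h₁ h₂
      · exact absurd h₂ (hjq _)
    · rfl
    · rw [Function.update_of_ne hne₁] at h₁
      rcases eq_or_ne i₂ i with rfl | hne
      · simp only [Function.update_self, List.mem_append, List.mem_singleton] at h₂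
        rcases h₂ with h₂ | rfl
        · exact h.unique _ _ _ h₁ h₂
        · exact absurd h₁ (hjq _)
      · rw [Function.update_of_ne hne] at h₂
        exact h.unique _ _ _ h₁ h₂
  · intro i'
    rcases eq_or_ne i' i with rfl | hne
    · rw [Function.update_self]
      exact (h.nodup _).append (List.nodup_singleton j) (by simpa using hjq _)
    · rw [Function.update_of_ne hne]
      exact h.nodup _
  · rw [hsum, ← h.sum_load, ← Finset.add_sum_erase _ _ hi, ← Finset.add_sum_erase _ _ hi,
      Function.update_self, hself]
    rw [Finset.sum_congr rfl fun i' hi' => by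
      rw [Function.update_of_ne (Finset.ne_of_mem_erase hi')]]
    ring
  · intro i' x l hq j' hj'
    rw [hsum]
    have := he j
    rcases eq_or_ne i' i with rfl | hne
    · rw [Function.update_self] at hq
      rcases hqi : q i' with _ | ⟨y, l'⟩
      · simp only [hqi, List.nil_append, List.cons.injEq] at hq
        simp [← hq.2] at hj'
      · rw [hqi, List.cons_append, List.cons.injEq] at hq
        rw [← hq.2, List.mem_append, List.mem_singleton] at hj'
        rcases hj' with hj' | rfl
        · linarith [h.card_mul_le _ _ _ hqi _ hj']
        · have := mul_le_mul_of_nonneg_left (hfirst y (by simp [hqi])) hcard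
          linarith
    · rw [Function.update_of_ne hne] at hq
      linarith [h.card_mul_le _ _ _ hq _ hj']
  · intro i' hlen
    rw [hsum]
    have := he j
    rcases eq_or_ne i' i with rfl | hne
    · rw [Function.update_self] at hlen ⊢
      rw [hself, mul_add]
      obtain ⟨x, hx⟩ : ∃ x, x ∈ q i' := by
        refine List.exists_mem_of_length_pos ?_
        simp only [List.length_append, List.length_singleton] at hlen
        omega
      have := mul_le_mul_of_nonneg_left (hfirst x hx) hcard
      linarith
    · rw [Function.update_of_ne hne] at hlen ⊢
      linarith [h.card_mul_load_le _ hlen]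

lemma isLeptAssignment_foldl (he : ∀ j, 0 ≤ e j) (rule : LEPTRule J M e) {A : Finset M}
    (hA : A.Nonempty) (L : List J) (hL : L.Nodup) (hs : L.Pairwise fun j j' => e j' ≤ e j) :
    IsLeptAssignment e A L (L.foldl (fun q j =>
      if A.Nonempty then
        let i := rule.pick A (fun i => ((q i).map e).sum)
        Function.update q i (q i ++ [j])
      else q) (fun _ => [])) := by
  induction L using List.reverseRecOn with
  | nil => constructor <;> simp
  | append_singleton L j ih =>
    rw [List.nodup_append] at hL
    rw [List.pairwise_append] at hs
    rw [List.foldl_append]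
    simp only [List.foldl_cons, List.foldl_nil, if_pos hA]
    refine (?_ : IsLeptAssignment e A L _).append he
      (fun hj => hL.2.2 j hj j (List.mem_singleton_self j) rfl)
      (fun x hx => hs.2.2 x hx j (List.mem_singleton_self j)) (rule.pick_mem _ _ hA)
      (rule.pick_le A fun i => (((List.foldl _ _ L : M → List J) i).map e).sum)
    have := ih hL.1 hs.1
    simpa only [if_pos hA] using this

variable [DecidableEq J]

lemma isLeptAssignment_leptQueues (he : ∀ j, 0 ≤ e j) (rule : LEPTRule J M e) (R : Finset J)
    {A : Finset M} (hA : A.Nonempty) :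
    IsLeptAssignment e A (rule.order.filter (fun j => j ∈ R)) (leptQueues rule R A) :=
  isLeptAssignment_foldl he rule hA _ (rule.nodup.filter _) (rule.sorted.filter _)

variable [Fintype M]

/-- A queued job that starts before `t` does not remain, so the two realizations agree on it.
Availability inspects the processing times of such jobs only. -/
lemma nextState_congr (rule : LEPTRule J M e) {p p' : J → ℝ} (hp : ∀ j, 0 ≤ p j)
    (hp' : ∀ j, 0 ≤ p' j) (r t : ℝ) (s : RoundState J M)
    (h : ∀ j ∉ (nextState rule p r t s).remaining, p j = p' j) :
    nextState rule p' r t s = nextState rule p r t s := by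
  have hq : ∀ i, ∀ j ∈ leptQueues rule s.remaining s.available i,
      startTime p r (leptQueues rule s.remaining s.available i) j < t → p j = p' j := by
    intro i j hj hlt
    refine h j fun hm => ?_
    exact absurd ((Finset.mem_filter.1 hm).2 i hj) (not_le.2 hlt)
  have key := fun i j hj => startTime_congr hp hp' (hq i) (j := j) hj
  refine RoundState.ext' ?_ ?_
  · refine Finset.filter_congr fun j _ => forall_congr' fun i => forall_congr' fun hj => ?_
    rcases key i j hj with h | ⟨h1, h2⟩
    · rw [h]
    · simp [h1, h2]
  · refine Finset.filter_congr fun i _ => forall_congr' fun j => forall_congr' fun hj => ?_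
    rcases key i j hj with h | ⟨h1, h2⟩
    · rw [h]
      exact forall_congr' fun hlt => by rw [hq i j hj hlt]
    · simp [not_lt.2 h1, not_lt.2 h2]

lemma remaining_nextState_subset (rule : LEPTRule J M e) (p : J → ℝ) (r t : ℝ)
    (s : RoundState J M) : (nextState rule p r t s).remaining ⊆ s.remaining :=
  Finset.filter_subset _ _

lemma available_nextState_subset (rule : LEPTRule J M e) (p : J → ℝ) (r t : ℝ)
    (s : RoundState J M) : (nextState rule p r t s).available ⊆ s.available :=
  Finset.filter_subset _ _

variable [Fintype J]

/-- The history up to `τ_k` depends only on the processing times of jobs started before `τ_k`. -/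
lemma state_congr (rule : LEPTRule J M e) {p p' : J → ℝ} (hp : ∀ j, 0 ≤ p j)
    (hp' : ∀ j, 0 ≤ p' j) (δ α : ℝ) (r : ℕ → ℝ) (k : ℕ)
    (h : ∀ j ∉ (state rule δ α r p k).remaining, p j = p' j) :
    state rule δ α r p' k = state rule δ α r p k := by
  induction k with
  | zero => rfl
  | succ k ih =>
    have := ih fun j hj => h j fun hm => hj (remaining_nextState_subset rule _ _ _ _ hm)
    simp only [state, this]
    exact nextState_congr rule hp hp' _ _ _ h

instance : Finite (RoundState J M) :=
  Finite.of_injective (fun s : RoundState J M => (s.remaining, s.available)) fun _ _ h =>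
    RoundState.ext' (congrArg Prod.fst h) (congrArg Prod.snd h)

lemma measurableSet_nextState_eq (rule : LEPTRule J M e) (r t : ℝ) (s s' : RoundState J M) :
    MeasurableSet {p : J → ℝ | nextState rule p r t s = s'} := by
  have h : {p : J → ℝ | nextState rule p r t s = s'} =
      {p | (∀ j, j ∈ (nextState rule p r t s).remaining ↔ j ∈ s'.remaining) ∧
        ∀ i, i ∈ (nextState rule p r t s).available ↔ i ∈ s'.available} := by
    ext p
    refine ⟨?_, fun h => RoundState.ext' (Finset.ext h.1) (Finset.ext h.2)⟩
    rintro rfl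
    simp
  rw [h]
  have hst := measurable_startTime (J := J)
  have hle : ∀ l j, Measurable fun p : J → ℝ => t ≤ startTime p r l j := fun l j =>
    measurableSet_setOfPred.1 (measurableSet_le measurable_const (hst r l j))
  have hlt : ∀ l j, Measurable fun p : J → ℝ => startTime p r l j < t := fun l j =>
    measurableSet_setOfPred.1 (measurableSet_lt (hst r l j) measurable_const)
  have hc : ∀ l j, Measurable fun p : J → ℝ => startTime p r l j + p j ≤ t := fun l j =>
    measurableSet_setOfPred.1
      (measurableSet_le ((hst r l j).add (measurable_pi_apply j)) measurable_const)
  refine measurableSet_setOfPred.2 (.and (.forall fun j => .iff ?_ measurable_const)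
    (.forall fun i => .iff ?_ measurable_const))
  · simp only [nextState, Finset.mem_filter]
    exact .and measurable_const (.forall fun i => .imp measurable_const (hle _ _))
  · simp only [nextState, Finset.mem_filter]
    exact .and measurable_const (.forall fun j => .imp measurable_const
      (.imp (hlt _ _) (hc _ _)))

lemma measurableSet_state_eq (rule : LEPTRule J M e) (δ α : ℝ) (r : ℕ → ℝ) (k : ℕ)
    (s : RoundState J M) : MeasurableSet {p : J → ℝ | state rule δ α r p k = s} := by
  induction k generalizing s with
  -- The initial state is the same for every realization; the zero realization is an arbitrary
  -- choice.
  | zero => exact .const (state rule δ α r 0 0 = s)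
  | succ k ih =>
    have : {p : J → ℝ | state rule δ α r p (k + 1) = s} =
        ⋃ s', {p | state rule δ α r p k = s'} ∩
          {p | nextState rule p (r k) (tau M e δ α (k + 1)) s' = s} := by
      ext p
      simp [state]
    rw [this]
    exact .iUnion fun s' => (ih s').inter (measurableSet_nextState_eq rule _ _ s' s)

end Queues

/-! ### Deterministic estimates for one round. -/

section Round

variable {J M : Type*} [DecidableEq J] [DecidableEq M] [Fintype M] {e : J → ℝ}

/-- The processing of the first job of a queue starts before `t`, so a job that remains is preceded
by a job of at least its expected processing time. -/
lemma exists_cons_of_mem_remaining_nextState (he : ∀ j, 0 ≤ e j) (rule : LEPTRule J M e)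
    {p : J → ℝ} {r t : ℝ} (hrt : r < t) {s : RoundState J M} (hA : s.available.Nonempty) {j : J}
    (hj : j ∈ (nextState rule p r t s).remaining) :
    ∃ i x l, leptQueues rule s.remaining s.available i = x :: l ∧ j ∈ l := by
  have h := isLeptAssignment_leptQueues he rule s.remaining hA
  obtain ⟨hjR, hjt⟩ := Finset.mem_filter.1 hj
  obtain ⟨i, hi⟩ := h.exists_mem j (by simp [rule.mem_order, hjR])
  have hst := hjt i hi
  rcases hq : leptQueues rule s.remaining s.available i with _ | ⟨x, l⟩
  · simp [hq] at hi
  · rw [hq, startTime_cons] at hst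
    rw [hq] at hi
    refine ⟨i, x, l, hq, (List.mem_cons.1 hi).resolve_left fun hjx => ?_⟩
    rw [if_pos hjx.symm] at hst
    linarith

/-- Controls the single-job queues of the following round, for which the LEPT load bound says
nothing. -/
lemma card_mul_le_of_mem_remaining_nextState (he : ∀ j, 0 ≤ e j) (rule : LEPTRule J M e)
    {p : J → ℝ} {r t : ℝ} (hrt : r < t) {s : RoundState J M} (hA : s.available.Nonempty) {j : J}
    (hj : j ∈ (nextState rule p r t s).remaining) :
    s.available.card * e j ≤ ∑ j ∈ s.remaining, e j := by
  obtain ⟨i, x, l, hq, hjl⟩ := exists_cons_of_mem_remaining_nextState he rule hrt hA hj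
  rw [← sum_map_order_filter rule]
  exact (isLeptAssignment_leptQueues he rule s.remaining hA).card_mul_le i x l hq j hjl

/-- A remaining job stands behind another one and starts no earlier than `t`, so its queue has at
least two jobs and total length at least `t - r`. Each such queue carries expected load at most `c`.
-/
lemma sum_remaining_nextState_le (he : ∀ j, 0 ≤ e j) (rule : LEPTRule J M e)
    {p : J → ℝ} (hp : ∀ j, 0 ≤ p j) {r t : ℝ} (hrt : r < t) {s : RoundState J M}
    (hA : s.available.Nonempty) {c : ℝ}
    (hc : ∀ i, 2 ≤ (leptQueues rule s.remaining s.available i).length →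
      ((leptQueues rule s.remaining s.available i).map e).sum ≤ c) :
    ∑ j ∈ (nextState rule p r t s).remaining, e j ≤
      c * countEvents s.available (fun i p =>
        2 ≤ (leptQueues rule s.remaining s.available i).length ∧
          t ≤ r + ((leptQueues rule s.remaining s.available i).map p).sum) p := by
  classical
  have h := isLeptAssignment_leptQueues he rule s.remaining hA
  set q := leptQueues rule s.remaining s.available with hq
  set B : Finset M := s.available.filter fun i =>
    2 ≤ (q i).length ∧ t ≤ r + ((q i).map p).sum with hB
  have hsub : (nextState rule p r t s).remaining ⊆ B.biUnion fun i => (q i).toFinset := by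
    intro j hj
    obtain ⟨i, x, l, hqi, hjl⟩ := exists_cons_of_mem_remaining_nextState he rule hrt hA hj
    have hjq : j ∈ q i := by rw [hq, hqi]; exact List.mem_cons_of_mem _ hjl
    refine Finset.mem_biUnion.2 ⟨i, Finset.mem_filter.2 ⟨(h.mem i j hjq).2, ?_, ?_⟩, by simpa⟩
    · have := List.length_pos_of_mem hjl
      rw [hq, hqi, List.length_cons]
      omega
    · have h1 := (Finset.mem_filter.1 hj).2 i hjq
      have h2 := startTime_add_le hp r hjq
      have h3 := hp j
      linarith
  calc ∑ j ∈ (nextState rule p r t s).remaining, e j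
      ≤ ∑ j ∈ B.biUnion fun i => (q i).toFinset, e j :=
        Finset.sum_le_sum_of_subset_of_nonneg hsub fun j _ _ => he j
    _ = ∑ i ∈ B, ((q i).map e).sum := by
        rw [Finset.sum_biUnion]
        · exact Finset.sum_congr rfl fun i _ => List.sum_toFinset _ (h.nodup i)
        · intro i _ i' _ hne
          refine Finset.disjoint_left.2 fun j hj hj' => hne ?_
          exact h.unique i i' j (by simpa using hj) (by simpa using hj')
    _ ≤ B.card • c := Finset.sum_le_card_nsmul _ _ _ fun i hi =>
        hc i (Finset.mem_filter.1 hi).2.1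
    _ = c * countEvents s.available (fun i p => 2 ≤ (q i).length ∧
          t ≤ r + ((q i).map p).sum) p := by
        rw [nsmul_eq_mul, mul_comm, countEvents, hB]
        congr!

lemma countEvents_le_card_available_nextState (rule : LEPTRule J M e)
    {p : J → ℝ} (hp : ∀ j, 0 ≤ p j) (r t : ℝ) (s : RoundState J M) :
    countEvents s.available (fun i p =>
        r + ((leptQueues rule s.remaining s.available i).map p).sum < t) p ≤
      (nextState rule p r t s).available.card := by
  refine Finset.card_le_card fun i hi => ?_
  rw [Finset.mem_filter] at hi
  exact Finset.mem_filter.2 ⟨hi.1, fun j hj _ => (startTime_add_le hp r hj).trans hi.2.le⟩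

omit [Fintype M] in
-- In the application `c` is the total expectation remaining one round earlier. `hR` handles the
-- queues with one job, the LEPT bound all longer ones.
lemma card_mul_load_le_of_forall_card_mul_le (he : ∀ j, 0 ≤ e j) (rule : LEPTRule J M e)
    {R : Finset J} {A : Finset M} (hA : A.Nonempty) {c : ℝ} (hc : ∑ j ∈ R, e j ≤ c)
    (hR : ∀ j ∈ R, A.card * e j ≤ c) (i : M) :
    A.card * ((leptQueues rule R A i).map e).sum ≤ 2 * c := by
  have h := isLeptAssignment_leptQueues he rule R hA
  have hc0 : 0 ≤ c := (Finset.sum_nonneg fun j _ => he j).trans hc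
  rcases le_or_gt 2 (leptQueues rule R A i).length with hl | hl
  · have := h.card_mul_load_le i hl
    rw [sum_map_order_filter] at this
    linarith
  · rcases hq : leptQueues rule R A i with _ | ⟨x, _ | ⟨y, l⟩⟩
    · simpa using hc0
    · have hx := (h.mem i x (by simp [hq])).1
      have := hR x (by simpa [rule.mem_order] using hx)
      simp only [List.map_cons, List.map_nil, List.sum_cons, List.sum_nil, add_zero]
      linarith
    · simp [hq] at hl

end Round

/-! ### Markov's inequality for a queue, and independence of the history from the remaining jobs. -/

section Probability

variable {J Ω : Type*} [MeasurableSpace Ω] {μ : Measure Ω} {P : J → Ω → ℝ}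

lemma integrable_sum_map (hPi : ∀ j, Integrable (P j) μ) (l : List J) :
    Integrable (fun ω => (l.map fun j => P j ω).sum) μ ∧
      ∫ ω, (l.map fun j => P j ω).sum ∂μ = (l.map fun j => ∫ ω, P j ω ∂μ).sum := by
  induction l with
  | nil => simp
  | cons x l ih =>
    simp only [List.map_cons, List.sum_cons]
    exact ⟨(hPi x).add ih.1, by rw [integral_add (hPi x) ih.1, ih.2]⟩

lemma measureReal_le_add_sum_map_le (hP0 : ∀ j ω, 0 ≤ P j ω) (hPi : ∀ j, Integrable (P j) μ)
    {r t q : ℝ} (hrt : r < t) {l : List J}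
    (hl : (l.map fun j => ∫ ω, P j ω ∂μ).sum ≤ q * (t - r)) :
    μ.real {ω | t ≤ r + (l.map fun j => P j ω).sum} ≤ q := by
  obtain ⟨h1, h2⟩ := integrable_sum_map hPi l
  have h := mul_meas_ge_le_integral_of_nonneg
    (.of_forall fun ω => List.sum_nonneg (by simpa using fun x _ => hP0 x ω)) h1 (t - r)
  simp only [h2, sub_le_iff_le_add'] at h
  have h3 : 0 < t - r := sub_pos.2 hrt
  refine le_of_mul_le_mul_left ?_ h3
  linarith

variable {M : Type*} [Fintype J] [DecidableEq J] [DecidableEq M] [Fintype M] {e : J → ℝ}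

/-- The history up to `τ_{k+1}` is independent of the processing times of the jobs that have not
been started by then. -/
lemma mul_measure_state_eq_le (hP : iIndepFun P μ) (hPm : ∀ j, Measurable (P j))
    (hP0 : ∀ j ω, 0 ≤ P j ω) [IsProbabilityMeasure μ]
    (rule : LEPTRule J M e) (δ α : ℝ) (r : ℕ → ℝ) (k : ℕ) (s' s : RoundState J M)
    {C : (J → ℝ) → Prop} (hC : MeasurableSet {p | C p}) {D : Finset J} (hCD : DependsOn C D)
    (hD : D ⊆ s.remaining) {c : ENNReal} (hc : c ≠ ⊤)
    (hcC : c.toReal ≤ μ.real {ω | C fun j => P j ω}) {F : Set Ω}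
    (hF : ∀ ω, state rule δ α r (fun j => P j ω) k = s' →
      state rule δ α r (fun j => P j ω) (k + 1) = s → C (fun j => P j ω) → ω ∈ F) :
    c * μ {ω | state rule δ α r (fun j => P j ω) k = s' ∧
        state rule δ α r (fun j => P j ω) (k + 1) = s} ≤
      μ ({ω | state rule δ α r (fun j => P j ω) k = s' ∧
        state rule δ α r (fun j => P j ω) (k + 1) = s} ∩ F) := by
  -- Erasing the processing times of the jobs remaining in `s` makes the history event a function
  -- `H` of the other jobs only; `hiff` shows by `state_congr` that the event is unchanged.
  let z : (J → ℝ) → J → ℝ := fun p j => if j ∈ s.remaining then 0 else p j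
  have hz : Measurable z := measurable_pi_lambda _ fun j => by
    by_cases h : j ∈ s.remaining
    · simp [z, h]
    · simpa [z, h] using measurable_pi_apply j
  let H : (J → ℝ) → Prop := fun p =>
    state rule δ α r (z p) k = s' ∧ state rule δ α r (z p) (k + 1) = s
  have hH : MeasurableSet {p | H p} :=
    (hz (measurableSet_state_eq rule δ α r k s')).inter
      (hz (measurableSet_state_eq rule δ α r (k + 1) s))
  have hHD : DependsOn H (s.remainingᶜ : Finset J) := by
    intro p p' h
    have : z p = z p' := by
      funext j
      by_cases hj : j ∈ s.remaining
      · simp [z, hj]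
      · simpa [z, hj] using h j (by simpa using hj)
    simp only [H, this]
  have hiff : ∀ ω, (state rule δ α r (fun j => P j ω) k = s' ∧
      state rule δ α r (fun j => P j ω) (k + 1) = s) ↔ H fun j => P j ω := by
    intro ω
    have hz0 : ∀ j, 0 ≤ z (fun j => P j ω) j := fun j => by
      dsimp only [z]
      split_ifs
      exacts [le_rfl, hP0 j ω]
    have hagree : ∀ j ∉ s.remaining, P j ω = z (fun j => P j ω) j := fun j hj => by simp [z, hj]
    constructor
    · rintro ⟨h1, h2⟩
      have h3 := state_congr rule (hP0 · ω) hz0 δ α r (k + 1)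
        fun j hj => hagree j (by rwa [h2] at hj)
      have h4 := state_congr rule (hP0 · ω) hz0 δ α r k fun j hj => hagree j fun hm => hj
        (remaining_nextState_subset rule _ _ _ _ (by rw [← h2] at hm; exact hm))
      exact ⟨h4.trans h1, h3.trans h2⟩
    · rintro ⟨h1, h2⟩
      have h3 := state_congr rule hz0 (hP0 · ω) δ α r (k + 1)
        fun j hj => (hagree j (by rwa [h2] at hj)).symm
      have h4 := state_congr rule hz0 (hP0 · ω) δ α r k fun j hj => (hagree j fun hm => hj
        (remaining_nextState_subset rule _ _ _ _ (by rw [← h2] at hm; exact hm))).symm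
      exact ⟨h4.trans h1, h3.trans h2⟩
  simp only [hiff]
  have hind := measureReal_inter_of_dependsOn hP hPm hH hC hHD hCD
    (disjoint_compl_left.mono_right hD)
  rw [← ENNReal.toReal_le_toReal (by finiteness) (by finiteness), ENNReal.toReal_mul]
  change c.toReal * μ.real _ ≤ μ.real _
  calc c.toReal * μ.real {ω | H fun j => P j ω}
      ≤ μ.real {ω | C fun j => P j ω} * μ.real {ω | H fun j => P j ω} := by gcongr
    _ = μ.real {ω | H (fun j => P j ω) ∧ C fun j => P j ω} := by rw [hind, mul_comm]
    _ ≤ μ.real ({ω | H fun j => P j ω} ∩ F) := measureReal_mono fun ω hω => by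
        obtain ⟨h1, h2⟩ := (hiff ω).2 hω.1
        exact ⟨hω.1, hF ω h1 h2 hω.2⟩

end Probability

/-! ### The two conditional bounds. -/

section Main

variable {J M Ω : Type*} [Fintype J] [DecidableEq J] [Fintype M] [DecidableEq M]
  [MeasurableSpace Ω] {μ : Measure Ω} [IsProbabilityMeasure μ] {P : J → Ω → ℝ} {e : J → ℝ}

omit [Fintype J] [Fintype M] [DecidableEq M] in
lemma IsLeptAssignment.pairwise_disjoint {A : Finset M} {L : List J} {q : M → List J}
    (h : IsLeptAssignment e A L q) :
    Pairwise fun i i' => Disjoint (q i).toFinset (q i').toFinset :=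
  fun i i' hne => Finset.disjoint_left.2 fun j hj hj' =>
    hne (h.unique i i' j (by simpa using hj) (by simpa using hj'))

omit [Fintype J] [Fintype M] in
lemma biUnion_leptQueues_subset (he : ∀ j, 0 ≤ e j) (rule : LEPTRule J M e) (R : Finset J)
    {A : Finset M} (hA : A.Nonempty) :
    (A.biUnion fun i => (leptQueues rule R A i).toFinset) ⊆ R := by
  intro j hj
  obtain ⟨i, _, hi⟩ := Finset.mem_biUnion.1 hj
  have := ((isLeptAssignment_leptQueues he rule R hA).mem i j (by simpa using hi)).1
  simpa [rule.mem_order] using this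

omit [IsProbabilityMeasure μ] in
lemma measurableSet_preimage_state (hPm : ∀ j, Measurable (P j)) (rule : LEPTRule J M e)
    (δ α : ℝ) (r : ℕ → ℝ) (k : ℕ) (s : RoundState J M × RoundState J M) :
    MeasurableSet ((fun ω => (state rule δ α r (fun j => P j ω) k,
      state rule δ α r (fun j => P j ω) (k + 1))) ⁻¹' {s}) := by
  have hPm' : Measurable fun ω j => P j ω := measurable_pi_lambda _ hPm
  convert (hPm' (measurableSet_state_eq rule δ α r k s.1)).inter
    (hPm' (measurableSet_state_eq rule δ α r (k + 1) s.2)) using 1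
  ext ω
  simp [Prod.ext_iff]

omit [DecidableEq M] [Fintype M] [Fintype J] in
lemma dependsOn_comp_map {β : Type*} (f : List ℝ → β) (l : List J) :
    DependsOn (fun p : J → ℝ => f (l.map p)) (l.toFinset : Finset J) := by
  intro p p' h
  have : l.map p = l.map p' := List.map_congr_left fun j hj => h j (by simpa using hj)
  simp only [this]

lemma binomial_le_cond_Xi (hP : iIndepFun P μ) (hPm : ∀ j, Measurable (P j))
    (hP0 : ∀ j ω, 0 ≤ P j ω) (hPi : ∀ j, Integrable (P j) μ) (he : e = fun j => ∫ ω, P j ω ∂μ)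
    (rule : LEPTRule J M e) (hM : 0 < Fintype.card M) (hT : 0 < horizon M e)
    (δ : ℝ) {α : ℝ} (hα : 0 < α) {r : ℕ → ℝ} (k : ℕ)
    (hr : α * horizon M e ≤ tau M e δ α (k + 2) - r (k + 1)) {ξ a : ℝ} (hξ : 0 < ξ) (ha : 0 < a)
    {q : unitInterval} (hq : (q : ℝ) = 2 * ξ / (a * α))
    (hE : μ {ω | Xi rule δ α r (k + 1) (fun j => P j ω) ≤ ξ ∧
      a ≤ Avail rule δ α r (k + 1) (fun j => P j ω)} ≠ 0) (u : ℝ) :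
    binomial (Fintype.card M) q {y | 2 * ξ / (a * Fintype.card M) * (y : ℝ) ≤ u} ≤
      cond μ {ω | Xi rule δ α r (k + 1) (fun j => P j ω) ≤ ξ ∧
        a ≤ Avail rule δ α r (k + 1) (fun j => P j ω)}
        {ω | Xi rule δ α r (k + 2) (fun j => P j ω) ≤ u} := by
  have he0 : ∀ j, 0 ≤ e j := fun j => by rw [he]; exact integral_nonneg (hP0 j)
  have hm : (0 : ℝ) < Fintype.card M := by exact_mod_cast hM
  set T := horizon M e with hTdef
  have hrt : r (k + 1) < tau M e δ α (k + 2) := by nlinarith [mul_pos hα hT]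
  refine le_cond_of_fiberwise
    (g := fun ω => (state rule δ α r (fun j => P j ω) k, state rule δ α r (fun j => P j ω) (k + 1)))
    (Q := fun s => (∑ j ∈ s.2.remaining, e j) / (T * Fintype.card M) ≤ ξ ∧
      a ≤ (s.2.available.card : ℝ) / Fintype.card M) ?_ hE ?_
  · exact measurableSet_preimage_state hPm rule δ α r k
  rintro ⟨s', s⟩ ⟨hR, hA⟩
  simp only at hR hA
  rw [div_le_iff₀ (by positivity)] at hR
  rw [le_div_iff₀ hm] at hA
  have hA0 : (0 : ℝ) < s.available.card := lt_of_lt_of_le (by positivity) hA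
  have hAne : s.available.Nonempty := Finset.card_pos.1 (by exact_mod_cast hA0)
  have hlept := isLeptAssignment_leptQueues he0 rule s.remaining hAne
  set Q := leptQueues rule s.remaining s.available with hQ
  -- Twice the average load: total at most `ξTm`, spread over at least `am` machines.
  have hload : ∀ i, 2 ≤ (Q i).length → ((Q i).map e).sum ≤ 2 * ξ * T / a := by
    intro i hi
    have h1 := hlept.card_mul_load_le i hi
    rw [sum_map_order_filter] at h1
    have h2 : 0 ≤ ((Q i).map e).sum := List.sum_nonneg (by simpa using fun x _ => he0 x)
    rw [le_div_iff₀ ha]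
    have h3 := mul_le_mul_of_nonneg_right hA h2
    refine le_of_mul_le_mul_right ?_ hm
    linarith
  have hqT : 2 * ξ * T / a ≤ q * (tau M e δ α (k + 2) - r (k + 1)) := by
    calc 2 * ξ * T / a = q * (α * T) := by rw [hq]; field_simp
      _ ≤ _ := mul_le_mul_of_nonneg_left hr q.2.1
  let B : M → (J → ℝ) → Prop := fun i p =>
    2 ≤ (Q i).length ∧ tau M e δ α (k + 2) ≤ r (k + 1) + ((Q i).map p).sum
  have hBm : ∀ i, MeasurableSet {p | B i p} := fun i =>
    (MeasurableSet.const _).inter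
      (measurableSet_le measurable_const (measurable_const.add (measurable_sum_map _)))
  have hBD : ∀ i, DependsOn (B i) ((Q i).toFinset : Finset J) := fun i =>
    dependsOn_comp_map (fun l => 2 ≤ (Q i).length ∧ tau M e δ α (k + 2) ≤ r (k + 1) + l.sum) _
  have hdisj : Pairwise fun i i' => Disjoint (Q i).toFinset (Q i').toFinset :=
    hlept.pairwise_disjoint
  have hBq : ∀ i ∈ s.available, μ.real {ω | B i fun j => P j ω} ≤ q := by
    intro i _
    by_cases hi : 2 ≤ (Q i).length
    · simp only [B, hi, true_and]
      refine measureReal_le_add_sum_map_le hP0 hPi hrt ?_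
      have := (hload i hi).trans hqT
      have hei : ∀ j, e j = ∫ ω, P j ω ∂μ := fun j => by rw [he]
      simpa only [← hei] using this
    · simpa [B, hi] using q.2.1
  have hL : IsLowerSet {y : ℕ | 2 * ξ / (a * Fintype.card M) * (y : ℝ) ≤ u} := by
    intro y y' hy h
    refine le_trans ?_ (Set.mem_ofPred_eq ▸ h)
    have : (y' : ℝ) ≤ y := by exact_mod_cast hy
    gcongr
  -- At most `m` machines are available, and further trials only increase the count.
  have hbin := binomial_real_le_of_isLowerSet hP hPm hBm hBD hdisj hBq
    (Finset.card_le_univ s.available) hL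
  have := mul_measure_state_eq_le hP hPm hP0 rule δ α r k s' s
    (C := fun p => countEvents s.available B p ∈
      {y : ℕ | 2 * ξ / (a * Fintype.card M) * (y : ℝ) ≤ u})
    (F := {ω | Xi rule δ α r (k + 2) (fun j => P j ω) ≤ u})
    (c := binomial (Fintype.card M) q {y | 2 * ξ / (a * Fintype.card M) * (y : ℝ) ≤ u})
    (measurable_countEvents s.available hBm .of_discrete)
    (D := s.available.biUnion fun i => (Q i).toFinset)
    (fun p p' h => by simp only [dependsOn_countEvents s.available hBD h])
    (biUnion_leptQueues_subset he0 rule s.remaining hAne)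
    (measure_ne_top _ _) hbin ?_
  · convert this using 3 <;> ext ω <;> simp
  · intro ω _ h2 hC
    refine le_trans ?_ (Set.mem_ofPred_eq ▸ hC)
    have := sum_remaining_nextState_le he0 rule (hP0 · ω) hrt hAne hload
    rw [Xi, state, h2, div_le_iff₀ (by positivity)]
    refine this.trans (le_of_eq ?_)
    rw [← hTdef]
    field_simp
    rfl

lemma binomial_le_cond_Avail (hP : iIndepFun P μ) (hPm : ∀ j, Measurable (P j))
    (hP0 : ∀ j ω, 0 ≤ P j ω) (hPi : ∀ j, Integrable (P j) μ) (he : e = fun j => ∫ ω, P j ω ∂μ)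
    (rule : LEPTRule J M e) (hM : 0 < Fintype.card M) (hT : 0 < horizon M e)
    (δ : ℝ) {α : ℝ} (hα : 0 < α) {r : ℕ → ℝ} (k : ℕ) (hr' : r k < tau M e δ α (k + 1))
    (hr : α * horizon M e ≤ tau M e δ α (k + 2) - r (k + 1)) {ξ a : ℝ} (ha : 0 < a)
    {q : unitInterval} (hq : (q : ℝ) = 2 * ξ / (a * α))
    (hE : μ {ω | Xi rule δ α r k (fun j => P j ω) ≤ ξ ∧
      a ≤ Avail rule δ α r (k + 1) (fun j => P j ω)} ≠ 0) (u : ℝ) :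
    binomial ⌈a * Fintype.card M⌉₊ (unitInterval.symm q)
        {z | u ≤ (z : ℝ) / (Fintype.card M : ℕ)} ≤
      cond μ {ω | Xi rule δ α r k (fun j => P j ω) ≤ ξ ∧
        a ≤ Avail rule δ α r (k + 1) (fun j => P j ω)}
        {ω | u ≤ Avail rule δ α r (k + 2) (fun j => P j ω)} := by
  have he0 : ∀ j, 0 ≤ e j := fun j => by rw [he]; exact integral_nonneg (hP0 j)
  have hm : (0 : ℝ) < Fintype.card M := by exact_mod_cast hM
  set T := horizon M e with hTdef
  have hrt : r (k + 1) < tau M e δ α (k + 2) := by nlinarith [mul_pos hα hT]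
  have hPm' : Measurable fun ω j => P j ω := measurable_pi_lambda _ hPm
  refine le_cond_of_fiberwise
    (g := fun ω => (state rule δ α r (fun j => P j ω) k, state rule δ α r (fun j => P j ω) (k + 1)))
    (Q := fun s => (∑ j ∈ s.1.remaining, e j) / (T * Fintype.card M) ≤ ξ ∧
      a ≤ (s.2.available.card : ℝ) / Fintype.card M) ?_ hE ?_
  · exact measurableSet_preimage_state hPm rule δ α r k
  rintro ⟨s', s⟩ ⟨hR, hA⟩
  simp only at hR hA
  rw [div_le_iff₀ (by positivity)] at hR
  rw [le_div_iff₀ hm] at hA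
  have hA0 : (0 : ℝ) < s.available.card := lt_of_lt_of_le (by positivity) hA
  have hAne : s.available.Nonempty := Finset.card_pos.1 (by exact_mod_cast hA0)
  rcases Set.eq_empty_or_nonempty ((fun ω => (state rule δ α r (fun j => P j ω) k,
    state rule δ α r (fun j => P j ω) (k + 1))) ⁻¹' {(s', s)}) with hempty | ⟨ω₀, hω₀⟩
  · simp [hempty]
  obtain ⟨h₀, h₁⟩ := Prod.mk.inj hω₀
  rw [state, h₀] at h₁
  have hAs : s.available ⊆ s'.available := h₁ ▸ available_nextState_subset rule _ _ _ _
  have hRs : s.remaining ⊆ s'.remaining := h₁ ▸ remaining_nextState_subset rule _ _ _ _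
  have hlept := isLeptAssignment_leptQueues he0 rule s.remaining hAne
  set Q := leptQueues rule s.remaining s.available with hQ
  -- No restriction on the length: the bound on `s'.remaining` also covers the jobs that are alone
  -- in their queue.
  have hload : ∀ i, ((Q i).map e).sum ≤ 2 * ξ * T / a := by
    intro i
    have h1 := card_mul_load_le_of_forall_card_mul_le he0 rule (R := s.remaining) hAne
      (c := ∑ j ∈ s'.remaining, e j)
      (Finset.sum_le_sum_of_subset_of_nonneg hRs fun j _ _ => he0 j)
      (fun j hj => by
        have h3 := card_mul_le_of_mem_remaining_nextState he0 rule hr' (hAne.mono hAs)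
          (h₁.symm ▸ hj)
        have h4 : (s.available.card : ℝ) ≤ s'.available.card := by
          exact_mod_cast Finset.card_le_card hAs
        exact (mul_le_mul_of_nonneg_right h4 (he0 j)).trans h3) i
    have h2 : 0 ≤ ((Q i).map e).sum := List.sum_nonneg (by simpa using fun x _ => he0 x)
    rw [le_div_iff₀ ha]
    have h3 := mul_le_mul_of_nonneg_right hA h2
    refine le_of_mul_le_mul_right ?_ hm
    linarith
  have hqT : 2 * ξ * T / a ≤ q * (tau M e δ α (k + 2) - r (k + 1)) := by
    calc 2 * ξ * T / a = q * (α * T) := by rw [hq]; field_simp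
      _ ≤ _ := mul_le_mul_of_nonneg_left hr q.2.1
  let B : M → (J → ℝ) → Prop := fun i p => r (k + 1) + ((Q i).map p).sum < tau M e δ α (k + 2)
  have hBm : ∀ i, MeasurableSet {p | B i p} := fun i =>
    measurableSet_lt (measurable_const.add (measurable_sum_map _)) measurable_const
  have hBD : ∀ i, DependsOn (B i) ((Q i).toFinset : Finset J) := fun i =>
    dependsOn_comp_map (fun l => r (k + 1) + l.sum < tau M e δ α (k + 2)) _
  have hdisj : Pairwise fun i i' => Disjoint (Q i).toFinset (Q i').toFinset :=
    hlept.pairwise_disjoint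
  have hBq : ∀ i ∈ s.available, (unitInterval.symm q : ℝ) ≤ μ.real {ω | B i fun j => P j ω} := by
    intro i _
    have h1 : μ.real {ω | tau M e δ α (k + 2) ≤ r (k + 1) + ((Q i).map fun j => P j ω).sum} ≤ q :=
      measureReal_le_add_sum_map_le hP0 hPi hrt <| by
        have := (hload i).trans hqT
        have hei : ∀ j, e j = ∫ ω, P j ω ∂μ := fun j => by rw [he]
        simpa only [← hei] using this
    have h2 := probReal_compl_eq_one_sub (μ := μ) (hPm' (hBm i))
    have h3 : ((fun ω j => P j ω) ⁻¹' {p | B i p})ᶜ =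
        {ω | tau M e δ α (k + 2) ≤ r (k + 1) + ((Q i).map fun j => P j ω).sum} := by
      ext ω
      simp [B]
    rw [h3] at h2
    rw [unitInterval.coe_symm_eq]
    change _ ≤ μ.real ((fun ω j => P j ω) ⁻¹' {p | B i p})
    linarith
  have hU : IsUpperSet {z : ℕ | u ≤ (z : ℝ) / (Fintype.card M : ℕ)} := by
    intro y y' hy h
    refine le_trans (Set.mem_ofPred_eq ▸ h) ?_
    have : (y : ℝ) ≤ y' := by exact_mod_cast hy
    gcongr
  have hbin := binomial_real_le_of_isUpperSet hP hPm hBm hBD hdisj hBq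
    (Nat.ceil_le.2 hA) hU
  have := mul_measure_state_eq_le hP hPm hP0 rule δ α r k s' s
    (C := fun p => countEvents s.available B p ∈ {z : ℕ | u ≤ (z : ℝ) / (Fintype.card M : ℕ)})
    (F := {ω | u ≤ Avail rule δ α r (k + 2) (fun j => P j ω)})
    (c := binomial ⌈a * Fintype.card M⌉₊ (unitInterval.symm q)
        {z | u ≤ (z : ℝ) / (Fintype.card M : ℕ)})
    (measurable_countEvents s.available hBm .of_discrete)
    (D := s.available.biUnion fun i => (Q i).toFinset)
    (fun p p' h => by simp only [dependsOn_countEvents s.available hBD h])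
    (biUnion_leptQueues_subset he0 rule s.remaining hAne)
    (measure_ne_top _ _) hbin ?_
  · convert this using 3 <;> ext ω <;> simp
  · intro ω _ h2 hC
    refine le_trans (Set.mem_ofPred_eq ▸ hC) ?_
    have := countEvents_le_card_available_nextState rule (hP0 · ω) (r (k + 1))
      (tau M e δ α (k + 2)) s
    rw [Avail, state, h2]
    gcongr

end Main

end StochScheduling

/-- A success probability `p` as in `hp` exists: `ξ < 1`, `a ≥ 1/2` and `α > 4` give `2ξ/(aα) < 1`.
-/
theorem mainTheorem2 {J M Ω : Type*} [Fintype J] [DecidableEq J] [Fintype M] [DecidableEq M]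
    [MeasurableSpace Ω] (μ : Measure Ω) [IsProbabilityMeasure μ]
    (P : J → Ω → ℝ) (hP_meas : ∀ j, Measurable (P j)) (hP_nonneg : ∀ j ω, 0 ≤ P j ω)
    (hP_int : ∀ j, Integrable (P j) μ) (hP_indep : iIndepFun P μ)
    (rule : StochScheduling.LEPTRule J M (fun j => ∫ ω, P j ω ∂μ))
    (hT : 0 < StochScheduling.horizon M (fun j => ∫ ω, P j ω ∂μ))
    (δ α : ℝ) (hδ : 0 ≤ δ) (hα : 4 < α)
    (r : ℕ → ℝ)
    (hr : ∀ k, StochScheduling.tau M (fun j => ∫ ω, P j ω ∂μ) δ α k ≤ r k ∧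
      r k ≤ StochScheduling.tau M (fun j => ∫ ω, P j ω ∂μ) δ α k + δ)
    (k : ℕ) (hk : 1 ≤ k) (ξ a : ℝ) (hξ : ξ ∈ Set.Ioo (0 : ℝ) 1)
    (ha : a ∈ Set.Icc (1 / 2 : ℝ) 1)
    (p : unitInterval) (hp : (p : ℝ) = 2 * ξ / (a * α)) :
    let X : ℕ → Ω → ℝ := fun i ω => StochScheduling.Xi rule δ α r i (fun j => P j ω)
    let A : ℕ → Ω → ℝ := fun i ω => StochScheduling.Avail rule δ α r i (fun j => P j ω)
    let m : ℕ := Fintype.card M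
    (μ {ω | X k ω ≤ ξ ∧ a ≤ A k ω} ≠ 0 → ∀ u : ℝ,
      binomial m p {y | 2 * ξ / (a * m) * (y : ℝ) ≤ u} ≤
        cond μ {ω | X k ω ≤ ξ ∧ a ≤ A k ω} {ω | X (k + 1) ω ≤ u}) ∧
    (μ {ω | X (k - 1) ω ≤ ξ ∧ a ≤ A k ω} ≠ 0 → ∀ u : ℝ,
      binomial ⌈a * m⌉₊ (unitInterval.symm p) {z | u ≤ (z : ℝ) / m} ≤
        cond μ {ω | X (k - 1) ω ≤ ξ ∧ a ≤ A k ω} {ω | u ≤ A (k + 1) ω}) := by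
  -- `pick` returns a machine even for the empty set, so `m ≥ 1`.
  have : Nonempty M := ⟨rule.pick ∅ 0⟩
  have ha0 : 0 < a := lt_of_lt_of_le (by norm_num) ha.1
  have hα0 : 0 < α := by linarith
  have hαT := mul_pos hα0 hT
  obtain ⟨k, rfl⟩ : ∃ k', k = k' + 1 := ⟨k - 1, by omega⟩
  -- The delay is at most `δ`, which leaves `αT` of each round for processing.
  have hgap : ∀ k, α * StochScheduling.horizon M (fun j => ∫ ω, P j ω ∂μ) ≤
      StochScheduling.tau M (fun j => ∫ ω, P j ω ∂μ) δ α (k + 1) - r k := by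
    intro k
    have := (hr k).2
    unfold StochScheduling.tau at this ⊢
    push_cast
    linarith
  exact ⟨StochScheduling.binomial_le_cond_Xi hP_indep hP_meas hP_nonneg hP_int rfl rule
      Fintype.card_pos hT δ hα0 k (hgap (k + 1)) hξ.1 ha0 hp,
    StochScheduling.binomial_le_cond_Avail hP_indep hP_meas hP_nonneg hP_int rfl rule
      Fintype.card_pos hT δ hα0 k (by linarith [hgap k]) (hgap (k + 1)) ha0 hp⟩
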